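/- Let $S=k[x_1,\dots,x_n]$ be a polynomial ring over a field $k$, and let $M\subseteq S$ be a monomial ideal with minimal generating set of monomials $G$. A monomial $m\in G$ is called dominant if there are a variable $x$ and an exponent $e\ge 1$ such that $x^e\mid m$ and $x^e\nmid m'$ for all $m'\in G\setminus\{m\}$; the ideal $M$ is called $2$-semidominant if exactly two elements of $G$ are not dominant. The Taylor resolution $\mathbb{T}_M$ of $S/M$ has one basis element $[\sigma]$ for every subset $\sigma\subseteq G$ (including $\sigma=\varnothing$), placed in homological degree $\#\sigma$, with multidegree $\operatorname{mdeg}[\sigma]=\operatorname{lcm}(\sigma)$ (where $\operatorname{lcm}(\varnothing)=1$) and differential $$[l_1,\dots,l_p]\longmapsto\sum_{i=1}^{p}(-1)^{i+1}\,\frac{\operatorname{mdeg}[l_1,\dots,l_p]}{\operatorname{mdeg}[l_1,\dots,\widehat{l_i},\dots,l_p]}\,[l_1,\dots,\widehat{l_i},\dots,l_p].$$ The Scarf complex of $M$ is the subcomplex of $\mathbb{T}_M$ spanned by the basis elements whose multidegree is not shared by any other basis element of $\mathbb{T}_M$, and $M$ is called Scarf if its Scarf complex is a free resolution of $S/M$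 (which is then automatically minimal). **Theorem 6.7 (Characterization of the Scarf 2-semidominant Ideals).** Let $M$ be a $2$-semidominant ideal. Let $B$ be the set of all monomials $m$ that are the multidegree of more than one basis element of $\mathbb{T}_M$, and for each $m\in B$ let $B_m=\{[\sigma]\in\mathbb{T}_M : \operatorname{mdeg}[\sigma]=m\}$. Then $M$ is Scarf if and only if $\#(B_m)$ is even for all $m\in B$. -/

import Mathlib

namespace MonomialResolution

open MvPolynomial

/-- A monomial `x₁^{a₁} ⋯ xₙ^{aₙ}`, given by its exponent vector. Divisibility of monomials is `≤`
and the least common multiple is `⊔`. -/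
abbrev Mon (n : ℕ) := Fin n →₀ ℕ

section Ideals

variable {k : Type*} [Field k] {n : ℕ}

/-- `M` is a monomial ideal: it is generated by a set of monomials. -/
def IsMonomialIdeal (M : Ideal (MvPolynomial (Fin n) k)) : Prop :=
  ∃ A : Set (Mon n), M = Ideal.span ((fun a => monomial a (1 : k)) '' A)

/-- The minimal generating set of a monomial ideal: the monomials of `M` that are minimal with
respect to divisibility. -/
def minGens (M : Ideal (MvPolynomial (Fin n) k)) : Set (Mon n) :=
  {a | Minimal (fun b => monomial b (1 : k) ∈ M) a}

theorem minGens_finite (M : Ideal (MvPolynomial (Fin n) k)) : (minGens M).Finite :=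
  WellQuasiOrderedLE.finite_of_isAntichain (setOfPred_minimal_antichain _)

/-- `minGens M` generates the monomial ideal `M`. -/
theorem span_minGens {M : Ideal (MvPolynomial (Fin n) k)} (hM : IsMonomialIdeal M) :
    Ideal.span ((fun a => monomial a (1 : k)) '' minGens M) = M := by
  apply le_antisymm
  · rw [Ideal.span_le]
    rintro _ ⟨a, ha, rfl⟩
    exact ha.1
  · obtain ⟨A, hA⟩ := hM
    conv_lhs => rw [hA]
    rw [Ideal.span_le]
    rintro _ ⟨a, ha, rfl⟩
    have haM : monomial a (1 : k) ∈ M := by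
      rw [hA]; exact Ideal.subset_span ⟨a, ha, rfl⟩
    obtain ⟨b, hb, hbm⟩ := exists_minimal_le_of_wellFoundedLT
      (fun b => monomial b (1 : k) ∈ M) a haM
    refine mem_ideal_span_monomial_image.2 fun x hx => ⟨b, hbm, ?_⟩
    have : x = a := by
      simpa using support_monomial_subset hx
    rwa [this]

/-- `minGens M` is contained in every set of monomials that generates `M`; together with
`span_minGens` it is the unique minimal set of monomial generators. -/
theorem minGens_subset {M : Ideal (MvPolynomial (Fin n) k)} {A : Set (Mon n)}
    (hA : M = Ideal.span ((fun a => monomial a (1 : k)) '' A)) : minGens M ⊆ A := by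
  intro a ha
  have h1 : monomial a (1 : k) ∈ M := ha.1
  rw [hA] at h1
  obtain ⟨b, hb, hba⟩ := mem_ideal_span_monomial_image.1 h1 a (by simp)
  have hbM : monomial b (1 : k) ∈ M := by
    rw [hA]; exact Ideal.subset_span ⟨b, hb, rfl⟩
  rwa [le_antisymm (ha.2 hbM hba) hba]

end Ideals

section Dominance

variable {n : ℕ}

/-- The monomial `m` is dominant with respect to `G`: it has a dominant variable `x`, that is, for
some positive `e` the power `x ^ e` divides `m` but no other element of `G`. -/
def IsDominant (G : Set (Mon n)) (m : Mon n) : Prop :=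
  ∃ x : Fin n, ∃ e : ℕ, 0 < e ∧ e ≤ m x ∧ ∀ m' ∈ G, m' ≠ m → ¬ e ≤ m' x

/-- A set of monomials is `p`-semidominant if exactly `p` of its elements are nondominant. -/
def IsSemidominantSet (p : ℕ) (G : Set (Mon n)) : Prop :=
  {m ∈ G | ¬ IsDominant G m}.encard = p

/-- A `p`-semidominant ideal is a monomial ideal whose minimal generating set is
`p`-semidominant. -/
def IsSemidominantIdeal {k : Type*} [Field k] (p : ℕ)
    (M : Ideal (MvPolynomial (Fin n) k)) : Prop :=
  IsMonomialIdeal M ∧ IsSemidominantSet p (minGens M)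

end Dominance

section Complexes

variable {n : ℕ}

/-- The multidegree of a basis element `[l₁, …, l_p]`: the least common multiple of the `lᵢ`
(the monomial `1` for the empty set). -/
noncomputable def mdeg (s : Finset (Mon n)) : Mon n := s.sup id

/-- The basis elements in homological degree `j` of the complex carried by a simplicial complex
`Δ` on a set of monomials (a family of finite sets closed under subsets): the faces with `j`
vertices. -/
abbrev Face (Δ : LowerSet (Finset (Mon n))) (j : ℕ) := {s : Finset (Mon n) // s ∈ Δ ∧ s.card = j}

/-- The face obtained by deleting the vertex `g`. -/
def Face.erase {Δ : LowerSet (Finset (Mon n))} {j : ℕ} (s : Face Δ (j + 1)) (g : Mon n)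
    (hg : g ∈ s.1) : Face Δ j :=
  ⟨s.1.erase g, Δ.lower (Finset.erase_subset g s.1) s.2.1, by
    rw [Finset.card_erase_of_mem hg, s.2.2]; rfl⟩

/-- The number of vertices of `s` that precede `g`, in the lexicographic order of exponent
vectors. -/
def position (s : Finset (Mon n)) (g : Mon n) : ℕ := (s.filter fun h => toLex h < toLex g).card

/-- The differential, from homological degree `j + 1` to `j`, of the complex of free modules carried
by `Δ`. If `l₁ < ⋯ < l_p` are the vertices of the face `s` then
`[s] ↦ ∑ᵢ (-1)^(i+1) (mdeg s / mdeg (s \ {lᵢ})) [s \ {lᵢ}]`. -/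
noncomputable def differential (k : Type*) [Field k] (Δ : LowerSet (Finset (Mon n))) (j : ℕ) :
    (Face Δ (j + 1) →₀ MvPolynomial (Fin n) k) →ₗ[MvPolynomial (Fin n) k]
      (Face Δ j →₀ MvPolynomial (Fin n) k) :=
  Finsupp.linearCombination (MvPolynomial (Fin n) k) fun s : Face Δ (j + 1) =>
    ∑ g ∈ s.1.attach, Finsupp.single (s.erase g.1 g.2)
      ((-1) ^ position s.1 g.1 * monomial (mdeg s.1 - mdeg (s.1.erase g.1)) (1 : k))

/-- The augmentation from homological degree `0` to `S / M`, sending `[∅]` to `1`. -/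
noncomputable def augmentation {k : Type*} [Field k] (Δ : LowerSet (Finset (Mon n)))
    (M : Ideal (MvPolynomial (Fin n) k)) :
    (Face Δ 0 →₀ MvPolynomial (Fin n) k) →ₗ[MvPolynomial (Fin n) k]
      (MvPolynomial (Fin n) k ⧸ M) :=
  Finsupp.linearCombination (MvPolynomial (Fin n) k) fun _ => (1 : MvPolynomial (Fin n) k ⧸ M)

/-- The complex of free modules carried by `Δ` is a free resolution of `S / M`: the augmented
sequence `⋯ → F₂ → F₁ → F₀ → S / M → 0` is exact. -/
def IsResolution {k : Type*} [Field k] (Δ : LowerSet (Finset (Mon n)))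
    (M : Ideal (MvPolynomial (Fin n) k)) : Prop :=
  Function.Surjective (augmentation Δ M) ∧
  Function.Exact (differential k Δ 0) (augmentation Δ M) ∧
  ∀ j : ℕ, Function.Exact (differential k Δ (j + 1)) (differential k Δ j)

end Complexes

section Scarf

variable {k : Type*} [Field k] {n : ℕ}

/-- The basis of the Taylor resolution of `S / M`: all sets of minimal generators, the empty set
included. -/
noncomputable def taylorBasis (M : Ideal (MvPolynomial (Fin n) k)) : Finset (Finset (Mon n)) :=
  (minGens_finite M).toFinset.powerset

/-- The basis elements of the Taylor resolution with multidegree `m`. -/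
noncomputable def taylorBasisOfMdeg (M : Ideal (MvPolynomial (Fin n) k)) (m : Mon n) :
    Finset (Finset (Mon n)) :=
  (taylorBasis M).filter fun s => mdeg s = m

/-- The Scarf complex of `M`: the basis elements of the Taylor resolution whose multidegree is
not shared by any other basis element. -/
def scarfComplex (M : Ideal (MvPolynomial (Fin n) k)) : LowerSet (Finset (Mon n)) where
  carrier := {s | s ∈ taylorBasis M ∧ ∀ t ∈ taylorBasis M, mdeg t = mdeg s → t = s}
  lower' := by
    rintro s t (hts : t ⊆ s) ⟨hs, hu⟩
    have hs' := Finset.mem_powerset.1 hs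
    refine ⟨Finset.mem_powerset.2 (hts.trans hs'), fun r hr hrt => ?_⟩
    have hr' := Finset.mem_powerset.1 hr
    have key : (s \ t) ∪ r = s := by
      refine hu _ (Finset.mem_powerset.2
        (Finset.union_subset (Finset.sdiff_subset.trans hs') hr')) ?_
      conv_rhs => rw [← Finset.sdiff_union_of_subset hts]
      simp only [mdeg, Finset.sup_union] at hrt ⊢
      rw [hrt]
    have htr : t ⊆ r := by
      intro x hx
      have hxs : x ∈ (s \ t) ∪ r := by rw [key]; exact hts hx
      rcases Finset.mem_union.1 hxs with h | h
      · exact absurd hx (Finset.mem_sdiff.1 h).2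
      · exact h
    refine (Finset.Subset.antisymm htr fun x hx => ?_).symm
    by_contra hxt
    have hxs : x ∈ s := by rw [← key]; exact Finset.mem_union_right _ hx
    have hte : t ⊆ s.erase x := fun y hy =>
      Finset.mem_erase.2 ⟨fun h => hxt (h ▸ hy), hts hy⟩
    have hx_le : x ≤ mdeg (s.erase x) :=
      calc x ≤ mdeg r := Finset.le_sup (f := id) hx
        _ = mdeg t := hrt
        _ ≤ mdeg (s.erase x) := Finset.sup_mono hte
    have heq : mdeg (s.erase x) = mdeg s := by
      conv_rhs => rw [← Finset.insert_erase hxs]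
      simp only [mdeg, Finset.sup_insert, id] at hx_le ⊢
      exact (sup_eq_right.2 hx_le).symm
    have := hu _ (Finset.mem_powerset.2 ((Finset.erase_subset x s).trans hs')) heq
    rw [← this] at hxs
    exact Finset.notMem_erase x s hxs

/-- `M` is a Scarf ideal: its Scarf complex is a free resolution of `S / M`. (Such a resolution is
automatically minimal, since a face and a facet in the Scarf complex have different
multidegrees.) -/
def IsScarf (M : Ideal (MvPolynomial (Fin n) k)) : Prop :=
  IsResolution (scarfComplex M) M

end Scarf

end MonomialResolution

/-! Multiplying the coefficient of each face by its multidegree turns the differential into the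
simplicial boundary, so a complex carried by `Δ` that contains the empty face and has its vertices
in `G` resolves `S / M`, for `G` generating `M`, exactly when for each monomial `a` in `M` the faces
with multidegree dividing `a` form a complex acyclic over `k` (`IsResolution.isAcyclic`,
`isResolution_of_isAcyclic`).

Scarf implies even: an acyclic complex has an even number of faces, the empty one included
(`IsAcyclic.even_card`). So has the full simplex on the generators dividing `a`; hence the shared
faces below `a` are even in number, and induction on divisibility isolates each multidegree.

Even implies Scarf: let `p`, `q` be the nondominant generators. Sets of equal multidegree agree
outside `p`, `q`, so a class lies among `s`, `s ∪ {p}`, `s ∪ {q}`, `s ∪ {p, q}`. Its size can be odd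
and above one only if it consists of the last three. With these excluded, toggling `p` when this
keeps the multidegree, and `q` otherwise, matches all shared faces in pairs. Collapsing the pairs
reduces the full simplex below `a` to the Scarf complex below `a` and preserves acyclicity
(`IsAcyclic.collapse`, `IsExceptionalPair.isAcyclic_of_matching`). -/

namespace MonomialResolution

open MvPolynomial

/-! ### Simplicial boundary, cones and elementary collapses -/

section Boundary

variable {R : Type*} [CommRing R] {n : ℕ} {G : Finset (Mon n)}

theorem position_insert_self (t : Finset (Mon n)) (g : Mon n) :
    position (insert g t) g = position t g := by
  simp [position, Finset.filter_insert]

theorem position_insert_of_lt {t : Finset (Mon n)} {g h : Mon n} (hg : g ∉ t)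
    (hlt : toLex g < toLex h) : position (insert g t) h = position t h + 1 := by
  rw [position, Finset.filter_insert, if_pos hlt, Finset.card_insert_of_notMem (by simp [hg])]
  rfl

theorem position_insert_of_gt {t : Finset (Mon n)} {g h : Mon n}
    (hlt : toLex h < toLex g) : position (insert g t) h = position t h := by
  rw [position, Finset.filter_insert, if_neg hlt.asymm]
  rfl

/-- Adding two vertices in the two possible orders gives opposite signs. -/
theorem sign_insert_comm {t : Finset (Mon n)} {g h : Mon n} (hg : g ∉ t) (hh : h ∉ t)
    (hgh : g ≠ h) :
    (-1 : R) ^ position t g * (-1) ^ position (insert g t) h =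
      -((-1) ^ position t h * (-1) ^ position (insert h t) g) := by
  rcases lt_or_gt_of_ne (fun e => hgh (toLex.injective e) : toLex g ≠ toLex h) with hlt | hlt
  · rw [position_insert_of_lt hg hlt, position_insert_of_gt hlt, pow_succ]; ring
  · rw [position_insert_of_gt hlt, position_insert_of_lt hh hlt, pow_succ]; ring

theorem sign_mul_self (i : ℕ) : (-1 : R) ^ i * (-1) ^ i = 1 := by
  rw [← mul_pow]; simp

variable (R G) in
/-- The simplicial boundary on functions on finite sets of monomials, with vertices in `G`. -/
def boundary : (Finset (Mon n) → R) →ₗ[R] (Finset (Mon n) → R) where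
  toFun c t := ∑ g ∈ G \ t, (-1) ^ position t g * c (insert g t)
  map_add' c d := by
    ext t
    simp [mul_add, Finset.sum_add_distrib]
  map_smul' r c := by
    ext t
    simp [Finset.mul_sum, mul_left_comm]

theorem boundary_apply (c : Finset (Mon n) → R) (t : Finset (Mon n)) :
    boundary R G c t = ∑ g ∈ G \ t, (-1) ^ position t g * c (insert g t) := rfl

/-- Exchanging the order in which two vertices are added pairs off the terms with opposite signs. -/
theorem boundary_boundary (c : Finset (Mon n) → R) : boundary R G (boundary R G c) = 0 := by
  ext t
  simp only [boundary_apply, Finset.mul_sum, Pi.zero_apply]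
  rw [Finset.sum_sigma']
  refine Finset.sum_involution (fun x _ => ⟨x.2, x.1⟩) ?_ ?_ ?_ ?_
  · rintro ⟨g, h⟩ hx
    simp only [Finset.mem_sigma, Finset.mem_sdiff, Finset.mem_insert, not_or] at hx
    obtain ⟨⟨-, hg⟩, -, hne, hh⟩ := hx
    rw [← mul_assoc, ← mul_assoc, sign_insert_comm hg hh (Ne.symm hne), Finset.insert_comm h g]
    ring
  · rintro ⟨g, h⟩ hx _ heq
    simp only [Finset.mem_sigma, Finset.mem_sdiff, Finset.mem_insert, not_or] at hx
    simp only [Sigma.mk.injEq] at heq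
    exact hx.2.2.1 heq.1
  · rintro ⟨g, h⟩ hx
    simp only [Finset.mem_sigma, Finset.mem_sdiff, Finset.mem_insert, not_or] at hx ⊢
    exact ⟨⟨hx.2.1, hx.2.2.2⟩, hx.1.1, Ne.symm hx.2.2.1, hx.1.2⟩
  · rintro ⟨g, h⟩ hx
    rfl

variable (R G) in
/-- The chains with support in `F` have no homology. -/
def IsAcyclic (F : Finset (Finset (Mon n))) : Prop :=
  ∀ c : Finset (Mon n) → R, (∀ s ∉ F, c s = 0) → boundary R G c = 0 →
    ∃ b : Finset (Mon n) → R, (∀ s ∉ F, b s = 0) ∧ boundary R G b = c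

/-- The full simplex on a nonempty set of vertices is acyclic. -/
theorem isAcyclic_powerset {A : Finset (Mon n)} (hA : A ⊆ G) (hne : A.Nonempty) :
    IsAcyclic R G A.powerset := by
  obtain ⟨v, hv⟩ := hne
  intro c hc hz
  -- The cone over `c` with apex `v`.
  refine ⟨fun s => if v ∈ s then (-1) ^ position s v * c (s.erase v) else 0, ?_, ?_⟩
  · intro s hs
    dsimp only
    split_ifs with hvs
    · rw [hc, mul_zero]
      simp only [Finset.mem_powerset] at hs ⊢
      intro h
      apply hs
      rw [← Finset.insert_erase hvs]
      exact Finset.insert_subset hv h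
    · rfl
  · ext t
    rw [boundary_apply]
    by_cases hvt : v ∈ t
    · obtain ⟨u, hvu, rfl⟩ : ∃ u, v ∉ u ∧ insert v u = t :=
        ⟨t.erase v, Finset.notMem_erase v t, Finset.insert_erase hvt⟩
      have h0 : boundary R G c u = 0 := congrFun hz u
      have hvG : v ∈ G \ u := Finset.mem_sdiff.2 ⟨hA hv, hvu⟩
      rw [boundary_apply, ← Finset.add_sum_erase _ _ hvG] at h0
      have hset : (G \ u).erase v = G \ insert v u := by
        ext x; simp only [Finset.mem_erase, Finset.mem_sdiff, Finset.mem_insert]; tauto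
      rw [hset] at h0
      have h1 : c (insert v u) = -((-1) ^ position u v *
          ∑ g ∈ G \ insert v u, (-1) ^ position u g * c (insert g u)) := by
        have := congrArg (fun x => (-1 : R) ^ position u v * x) h0
        simp only [mul_add, ← mul_assoc, sign_mul_self, one_mul, mul_zero] at this
        exact eq_neg_of_add_eq_zero_left this
      rw [h1, Finset.mul_sum, ← Finset.sum_neg_distrib]
      refine Finset.sum_congr rfl fun g hg => ?_
      simp only [Finset.mem_sdiff, Finset.mem_insert, not_or] at hg
      obtain ⟨-, hgv, hgu⟩ := hg
      have he : (insert g (insert v u)).erase v = insert g u := by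
        rw [Finset.insert_comm, Finset.erase_insert]
        simp [Ne.symm hgv, hvu]
      rw [if_pos (by simp), he, Finset.insert_comm, position_insert_self, ← mul_assoc,
        ← mul_assoc, ← neg_mul]
      congr 1
      have h2 := sign_insert_comm (R := R) hvu hgu (Ne.symm hgv)
      have h3 := sign_mul_self (R := R) (position u v)
      have h4 := sign_mul_self (R := R) (position u g)
      set A := (-1 : R) ^ position u v
      set B := (-1 : R) ^ position u g
      set C := (-1 : R) ^ position (insert v u) g
      set D := (-1 : R) ^ position (insert g u) v
      linear_combination (A * D) * h2 - C * D * h3 - A * B * (sign_mul_self (R := R) (position (insert g u) v))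
    · rw [Finset.sum_eq_single v]
      · rw [if_pos (by simp), Finset.erase_insert hvt, position_insert_self, ← mul_assoc,
          sign_mul_self, one_mul]
      · intro g _ hgv
        rw [if_neg (by simp [Ne.symm hgv, hvt]), mul_zero]
      · intro h
        exact absurd (Finset.mem_sdiff.2 ⟨hA hv, hvt⟩) h

/-- An elementary collapse preserves acyclicity. -/
theorem IsAcyclic.collapse {F : Finset (Finset (Mon n))} (hF : IsAcyclic R G F)
    (hlow : ∀ s ∈ F, ∀ t ⊆ s, t ∈ F) {s : Finset (Mon n)} {v : Mon n} (hvs : v ∉ s) (hv : v ∈ G)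
    (he : insert v s ∈ F) (hfree : ∀ t ∈ F, s ⊂ t → t = insert v s) :
    IsAcyclic R G ((F.erase s).erase (insert v s)) := by
  intro c hc hz
  obtain ⟨b, hb, hbc⟩ := hF c (fun t ht => hc t fun h =>
    ht (Finset.mem_of_mem_erase (Finset.mem_of_mem_erase h))) hz
  have hvGs : v ∈ G \ s := Finset.mem_sdiff.2 ⟨hv, hvs⟩
  -- Since `s` is a free face, `insert v s` is the only face of `F` that contributes to the boundary
  -- at `s`, where `c` vanishes.
  have hbe : b (insert v s) = 0 := by
    have h1 : boundary R G b s = 0 := by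
      rw [hbc]; exact hc s (by simp)
    rw [boundary_apply, Finset.sum_eq_single v _ (fun h => absurd hvGs h)] at h1
    · have := congrArg (fun x => (-1 : R) ^ position s v * x) h1
      simpa only [← mul_assoc, sign_mul_self, one_mul, mul_zero] using this
    · intro g hg hgv
      have hgs := (Finset.mem_sdiff.1 hg).2
      rw [hb, mul_zero]
      intro h
      have h2 := hfree _ h (Finset.ssubset_insert hgs)
      have h3 : g ∈ insert v s := h2 ▸ Finset.mem_insert_self g s
      rcases Finset.mem_insert.1 h3 with h4 | h4
      · exact hgv h4
      · exact hgs h4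
  -- Subtracting the boundary of `δ` cancels the value of `b` at `s` without changing its boundary.
  set δ : Finset (Mon n) → R := Pi.single (insert v s) ((-1) ^ position s v * b s) with hδ
  have hδs : boundary R G δ s = b s := by
    rw [boundary_apply, Finset.sum_eq_single v _ (fun h => absurd hvGs h)]
    · rw [hδ, Pi.single_eq_same, ← mul_assoc, sign_mul_self, one_mul]
    · intro g hg hgv
      rw [hδ, Pi.single_eq_of_ne, mul_zero]
      intro h2
      have h3 : g ∈ insert v s := h2 ▸ Finset.mem_insert_self g s
      rcases Finset.mem_insert.1 h3 with h4 | h4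
      · exact hgv h4
      · exact (Finset.mem_sdiff.1 hg).2 h4
  have hδ0 : ∀ t, ¬ t ⊂ insert v s → boundary R G δ t = 0 := by
    intro t ht
    rw [boundary_apply]
    refine Finset.sum_eq_zero fun g hg => ?_
    rw [hδ, Pi.single_eq_of_ne, mul_zero]
    intro h
    exact ht (h ▸ Finset.ssubset_insert (Finset.mem_sdiff.1 hg).2)
  refine ⟨b - boundary R G δ, ?_, by rw [map_sub, boundary_boundary, sub_zero, hbc]⟩
  intro t ht
  rw [Pi.sub_apply]
  by_cases hts : t = s
  · rw [hts, hδs, sub_self]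
  by_cases hte : t = insert v s
  · rw [hte, hbe, hδ0 _ (ssubset_irrefl _), sub_zero]
  have htF : t ∉ F := fun h => ht (Finset.mem_erase.2 ⟨hte, Finset.mem_erase.2 ⟨hts, h⟩⟩)
  rw [hb t htF, hδ0 t fun h => htF (hlow _ he _ h.1), sub_zero]

end Boundary

/-! ### Parity of the number of faces of an acyclic complex -/

section Parity

variable {k : Type*} [Field k] {n : ℕ} {G : Finset (Mon n)}

/-- By rank–nullity the dimension is twice the rank. The chains of all degrees are treated as one
space, so no grading is needed. -/
theorem even_finrank_of_ker_eq_range {V : Type*} [AddCommGroup V] [Module k V]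
    [FiniteDimensional k V] (f : V →ₗ[k] V) (h : LinearMap.ker f = LinearMap.range f) :
    Even (Module.finrank k V) := by
  rw [← f.finrank_range_add_finrank_ker, h]
  exact ⟨_, rfl⟩

/-- An acyclic simplicial complex has an even number of faces, the empty one included. -/
theorem IsAcyclic.even_card {F : Finset (Finset (Mon n))} (hF : IsAcyclic k G F)
    (hlow : ∀ s ∈ F, ∀ t ⊆ s, t ∈ F) : Even F.card := by
  let ι : (F → k) →ₗ[k] (Finset (Mon n) → k) := Function.ExtendByZero.linearMap k Subtype.val
  have hι : ∀ c (s : F), ι c s = c s := fun c s => Subtype.val_injective.extend_apply c 0 s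
  have hι0 : ∀ c, ∀ s ∉ F, ι c s = 0 := fun c s hs =>
    Function.extend_apply' (f := Subtype.val) c 0 s (by rintro ⟨a, rfl⟩; exact hs a.2)
  let ρ : (Finset (Mon n) → k) →ₗ[k] (F → k) := LinearMap.funLeft k k Subtype.val
  have hιρ : ∀ c : Finset (Mon n) → k, (∀ s ∉ F, c s = 0) → ι (ρ c) = c := by
    intro c hc
    ext s
    by_cases hs : s ∈ F
    · exact hι (ρ c) ⟨s, hs⟩
    · rw [hι0 _ s hs, hc s hs]
  have hρι : ∀ c, ρ (ι c) = c := fun c => funext fun s => hι c s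
  -- Closure under subsets keeps the boundary inside `F`, so it restricts to an endomorphism of `F →
  -- k`.
  have hb : ∀ c : Finset (Mon n) → k, (∀ s ∉ F, c s = 0) → ∀ s ∉ F, boundary k G c s = 0 := by
    intro c hc s hs
    rw [boundary_apply]
    refine Finset.sum_eq_zero fun g _ => ?_
    rw [hc, mul_zero]
    exact fun h => hs (hlow _ h _ (Finset.subset_insert _ _))
  have := even_finrank_of_ker_eq_range (ρ ∘ₗ boundary k G ∘ₗ ι) (by
    ext c
    simp only [LinearMap.mem_ker, LinearMap.mem_range, LinearMap.comp_apply]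
    constructor
    · intro h
      have h1 : boundary k G (ι c) = 0 := by
        rw [← hιρ _ (hb _ (hι0 c)), h, map_zero]
      obtain ⟨b, hb0, hbc⟩ := hF _ (hι0 c) h1
      exact ⟨ρ b, by rw [hιρ b hb0, hbc, hρι]⟩
    · rintro ⟨b, rfl⟩
      rw [hιρ _ (hb _ (hι0 b)), boundary_boundary, map_zero])
  simpa using this

end Parity

/-! ### From the multigraded differential to the simplicial boundary -/

section Homogenization

variable {k : Type*} [Field k] {n : ℕ} {Δ : LowerSet (Finset (Mon n))} {G : Finset (Mon n)}

open Classical in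
/-- The chain `z` with the coefficient of each face multiplied by the multidegree of the face,
extended by zero to all finite sets of monomials. -/
noncomputable def homogenize {j : ℕ} (z : Face Δ j →₀ MvPolynomial (Fin n) k)
    (t : Finset (Mon n)) : MvPolynomial (Fin n) k :=
  if h : t ∈ Δ ∧ t.card = j then monomial (mdeg t) 1 * z ⟨t, h⟩ else 0

theorem homogenize_face {j : ℕ} (z : Face Δ j →₀ MvPolynomial (Fin n) k) (s : Face Δ j) :
    homogenize z s.1 = monomial (mdeg s.1) 1 * z s := dif_pos s.2

theorem homogenize_of_not {j : ℕ} (z : Face Δ j →₀ MvPolynomial (Fin n) k) {t : Finset (Mon n)}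
    (h : ¬ (t ∈ Δ ∧ t.card = j)) : homogenize z t = 0 := dif_neg h

theorem homogenize_add {j : ℕ} (z w : Face Δ j →₀ MvPolynomial (Fin n) k) :
    homogenize (z + w) = homogenize z + homogenize w := by
  ext1 t
  by_cases h : t ∈ Δ ∧ t.card = j
  · simp [homogenize, h, mul_add]
  · simp [homogenize, h]

theorem homogenize_zero {j : ℕ} :
    homogenize (0 : Face Δ j →₀ MvPolynomial (Fin n) k) = 0 := by
  ext1 t
  by_cases h : t ∈ Δ ∧ t.card = j
  · simp [homogenize, h]
  · simp [homogenize, h]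

/-- Monomials cancel in the polynomial ring, so identities between chains may be checked after
homogenization. -/
theorem homogenize_injective {j : ℕ} :
    Function.Injective (homogenize : (Face Δ j →₀ MvPolynomial (Fin n) k) → _) := by
  intro z w h
  ext1 s
  have := congrFun h s.1
  rw [homogenize_face, homogenize_face] at this
  exact mul_left_cancel₀ (by simp) this

theorem homogenize_single {j : ℕ} (s : Face Δ j) (r : MvPolynomial (Fin n) k) :
    homogenize (Finsupp.single s r) = Pi.single s.1 (monomial (mdeg s.1) 1 * r) := by
  ext1 t
  by_cases ht : t = s.1
  · subst ht
    simp [homogenize_face]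
  · rw [Pi.single_eq_of_ne ht]
    by_cases h : t ∈ Δ ∧ t.card = j
    · have := homogenize_face (Finsupp.single s r) ⟨t, h⟩
      rw [this, Finsupp.single_eq_of_ne, mul_zero]
      rintro rfl
      exact ht rfl
    · exact homogenize_of_not _ h

theorem homogenize_sum {ι : Type*} {j : ℕ} (I : Finset ι)
    (z : ι → Face Δ j →₀ MvPolynomial (Fin n) k) :
    homogenize (∑ i ∈ I, z i) = ∑ i ∈ I, homogenize (z i) :=
  map_sum (AddMonoidHom.mk' homogenize homogenize_add) z I

theorem differential_single {j : ℕ} (s : Face Δ (j + 1)) (r : MvPolynomial (Fin n) k) :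
    differential k Δ j (Finsupp.single s r) = ∑ g ∈ s.1.attach, Finsupp.single (s.erase g.1 g.2)
      (r * ((-1) ^ position s.1 g.1 * monomial (mdeg s.1 - mdeg (s.1.erase g.1)) (1 : k))) := by
  rw [differential, Finsupp.linearCombination_single, Finset.smul_sum]
  simp only [Finsupp.smul_single, smul_eq_mul]

theorem mdeg_mono {s t : Finset (Mon n)} (h : s ⊆ t) : mdeg s ≤ mdeg t := Finset.sup_mono h

/-- After homogenization the differential becomes the simplicial boundary. -/
theorem homogenize_differential (hG : ∀ s ∈ Δ, s ⊆ G) {j : ℕ}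
    (z : Face Δ (j + 1) →₀ MvPolynomial (Fin n) k) :
    homogenize (differential k Δ j z) = boundary _ G (homogenize z) := by
  induction z using Finsupp.induction_linear with
  | zero => rw [map_zero, homogenize_zero, homogenize_zero, map_zero]
  | add z w hz hw => rw [map_add, homogenize_add, homogenize_add, map_add, hz, hw]
  | single s r =>
    rw [differential_single, homogenize_sum]
    ext1 t
    have h1 : ∀ g ∈ s.1.attach, homogenize (Finsupp.single (s.erase g.1 g.2)
        (r * ((-1) ^ position s.1 g.1 *
          monomial (mdeg s.1 - mdeg (s.1.erase g.1)) (1 : k)))) t =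
        (fun g => if s.1.erase g = t then (-1) ^ position s.1 g * (monomial (mdeg s.1) 1 * r)
          else 0) g.1 := by
      rintro ⟨g, hg⟩ -
      rw [homogenize_single]
      change (Pi.single (s.1.erase g) _ : Finset (Mon n) → MvPolynomial (Fin n) k) t = _
      dsimp only
      split_ifs with h
      · have hle : mdeg (s.1.erase g) ≤ mdeg s.1 := mdeg_mono (Finset.erase_subset _ _)
        -- The quotient of multidegrees in the differential is absorbed here.
        have hm : (monomial (mdeg s.1) (1 : k)) = monomial (mdeg (s.1.erase g)) 1 *
            monomial (mdeg s.1 - mdeg (s.1.erase g)) 1 := by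
          rw [monomial_mul, one_mul, add_tsub_cancel_of_le hle]
        subst h
        rw [Pi.single_eq_same, hm]
        change monomial (mdeg (s.1.erase g)) 1 * _ = _
        ring
      · exact Pi.single_eq_of_ne (Ne.symm h) _
    rw [Finset.sum_apply, Finset.sum_congr rfl h1, Finset.sum_attach s.1 (fun g =>
      if s.1.erase g = t then (-1) ^ position s.1 g * (monomial (mdeg s.1) 1 * r) else 0),
      homogenize_single, boundary_apply, ← Finset.sum_filter]
    have h2 : ∀ g ∈ G \ t, (-1) ^ position t g * (Pi.single s.1 (monomial (mdeg s.1) 1 * r) :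
        Finset (Mon n) → MvPolynomial (Fin n) k) (insert g t) =
        if insert g t = s.1 then (-1) ^ position s.1 g * (monomial (mdeg s.1) 1 * r) else 0 := by
      intro g _
      split_ifs with h
      · rw [h, Pi.single_eq_same, ← h, position_insert_self]
      · rw [Pi.single_eq_of_ne h, mul_zero]
    rw [Finset.sum_congr rfl h2, ← Finset.sum_filter]
    refine Finset.sum_congr ?_ fun _ _ => rfl
    ext g
    simp only [Finset.mem_filter, Finset.mem_sdiff]
    constructor
    · rintro ⟨hg, rfl⟩
      exact ⟨⟨hG _ s.2.1 hg, Finset.notMem_erase _ _⟩, Finset.insert_erase hg⟩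
    · rintro ⟨⟨-, hgt⟩, h⟩
      rw [← h]
      exact ⟨Finset.mem_insert_self _ _, Finset.erase_insert hgt⟩

/-- The boundary has only signs as coefficients, so exactness can be studied one multidegree at a
time, over `k`. -/
theorem coeff_boundary (c : Finset (Mon n) → MvPolynomial (Fin n) k) (a : Mon n) :
    (fun s => coeff a (boundary _ G c s)) = boundary k G fun s => coeff a (c s) := by
  ext t
  simp only [boundary_apply, coeff_sum]
  refine Finset.sum_congr rfl fun g _ => ?_
  rcases neg_one_pow_eq_or (MvPolynomial (Fin n) k) (position t g) with h | h <;>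
  rcases Nat.even_or_odd (position t g) with h' | h' <;> simp [h'.neg_one_pow]

theorem coeff_homogenize_of_not_le {j : ℕ} (z : Face Δ j →₀ MvPolynomial (Fin n) k)
    {t : Finset (Mon n)} {a : Mon n} (h : ¬ (t ∈ Δ ∧ mdeg t ≤ a ∧ t.card = j)) :
    coeff a (homogenize z t) = 0 := by
  by_cases h1 : t ∈ Δ ∧ t.card = j
  · rw [homogenize_face z ⟨t, h1⟩, coeff_monomial_mul', if_neg fun h2 => h ⟨h1.1, h2, h1.2⟩]
  · rw [homogenize_of_not z h1, coeff_zero]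

/-- A family of functions supported in the right multidegrees comes from a chain. -/
theorem exists_homogenize_eq (hG : ∀ s ∈ Δ, s ⊆ G) {j : ℕ} (A : Finset (Mon n))
    (y : Mon n → Finset (Mon n) → k)
    (hy : ∀ a t, ¬ (t ∈ Δ ∧ mdeg t ≤ a ∧ t.card = j) → y a t = 0) :
    ∃ z : Face Δ j →₀ MvPolynomial (Fin n) k,
      ∀ t, homogenize z t = ∑ a ∈ A, monomial a (y a t) := by
  have hfin : Finite (Face Δ j) :=
    Finite.of_injective (fun s : Face Δ j => (⟨s.1, Finset.mem_powerset.2 (hG _ s.2.1)⟩ :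
      {s // s ∈ G.powerset})) fun s t h => by
        apply Subtype.ext
        simpa using h
  -- The truncated subtraction is harmless: by `hy` the coefficient is zero unless `mdeg s.1 ≤ a`.
  refine ⟨Finsupp.equivFunOnFinite.symm fun s => ∑ a ∈ A, monomial (a - mdeg s.1) (y a s.1),
    fun t => ?_⟩
  by_cases h : t ∈ Δ ∧ t.card = j
  · rw [homogenize_face _ ⟨t, h⟩, Finsupp.equivFunOnFinite_symm_apply_apply, Finset.mul_sum]
    refine Finset.sum_congr rfl fun a _ => ?_
    dsimp only
    by_cases hle : mdeg t ≤ a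
    · rw [monomial_mul, one_mul, add_tsub_cancel_of_le hle]
    · rw [hy a t fun h' => hle h'.2.1]; simp
  · rw [homogenize_of_not _ h]
    symm
    refine Finset.sum_eq_zero fun a _ => ?_
    rw [hy a t fun h' => h ⟨h'.1, h'.2.2⟩, monomial_zero]

end Homogenization

/-! ### Resolutions and acyclicity in each multidegree -/

section Resolution

variable {k : Type*} [Field k] {n : ℕ} {Δ : LowerSet (Finset (Mon n))} {G : Finset (Mon n)}
  {M : Ideal (MvPolynomial (Fin n) k)}

open Classical in
/-- The faces of `Δ` whose multidegree divides `a`. -/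
noncomputable def facesLE (Δ : LowerSet (Finset (Mon n))) (G : Finset (Mon n)) (a : Mon n) :
    Finset (Finset (Mon n)) :=
  G.powerset.filter fun s => s ∈ Δ ∧ mdeg s ≤ a

theorem mem_facesLE (hG : ∀ s ∈ Δ, s ⊆ G) {a : Mon n} {s : Finset (Mon n)} :
    s ∈ facesLE Δ G a ↔ s ∈ Δ ∧ mdeg s ≤ a := by
  simp only [facesLE, Finset.mem_filter, Finset.mem_powerset, and_iff_right_iff_imp]
  exact fun h => hG s h.1

theorem facesLE_lower (hG : ∀ s ∈ Δ, s ⊆ G) {a : Mon n} :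
    ∀ s ∈ facesLE Δ G a, ∀ t ⊆ s, t ∈ facesLE Δ G a := by
  intro s hs t hts
  rw [mem_facesLE hG] at hs ⊢
  exact ⟨Δ.lower hts hs.1, (mdeg_mono hts).trans hs.2⟩

/-- The boundary lowers cardinality by one. This links the ungraded `IsAcyclic` to exactness in each
homological degree. -/
theorem boundary_homogeneous {R : Type*} [CommRing R] (c : Finset (Mon n) → R) (j : ℕ) :
    boundary R G (fun s => if s.card = j + 1 then c s else 0) =
      fun t => if t.card = j then boundary R G c t else 0 := by
  ext t
  simp only [boundary_apply]
  split_ifs with h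
  · refine Finset.sum_congr rfl fun g hg => ?_
    rw [Finset.card_insert_of_notMem (Finset.mem_sdiff.1 hg).2, if_pos (by rw [h])]
  · refine Finset.sum_eq_zero fun g hg => ?_
    rw [Finset.card_insert_of_notMem (Finset.mem_sdiff.1 hg).2,
      if_neg (fun h' => h (Nat.succ_injective h')), mul_zero]

theorem boundary_homogeneous_zero {R : Type*} [CommRing R] (c : Finset (Mon n) → R) :
    boundary R G (fun s => if s.card = 0 then c s else 0) = 0 := by
  ext t
  rw [boundary_apply]
  exact Finset.sum_eq_zero fun g hg => by simp

theorem augmentation_eq (z : Face Δ 0 →₀ MvPolynomial (Fin n) k) :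
    augmentation Δ M z = Ideal.Quotient.mk M (homogenize z ∅) := by
  induction z using Finsupp.induction_linear with
  | zero => simp [homogenize_zero]
  | add z w hz hw => rw [map_add, homogenize_add, Pi.add_apply, map_add, hz, hw]
  | single s r =>
    have hs : s.1 = ∅ := Finset.card_eq_zero.1 s.2.2
    rw [homogenize_single, hs, Pi.single_eq_same, augmentation, Finsupp.linearCombination_single]
    have : mdeg (∅ : Finset (Mon n)) = 0 := rfl
    rw [this]
    change r • Ideal.Quotient.mk M 1 = _
    rw [← Ideal.Quotient.mk_eq_mk, ← Submodule.Quotient.mk_smul]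
    simp

theorem differential_differential (hG : ∀ s ∈ Δ, s ⊆ G) {j : ℕ}
    (z : Face Δ (j + 2) →₀ MvPolynomial (Fin n) k) :
    differential k Δ j (differential k Δ (j + 1) z) = 0 := by
  apply homogenize_injective
  rw [homogenize_differential hG, homogenize_differential hG, boundary_boundary, homogenize_zero]

/-- If the complex carried by `Δ` is a resolution of `S / M` then it is exact in each
multidegree that belongs to `M`. -/
theorem IsResolution.isAcyclic (hres : IsResolution Δ M) (hG : ∀ s ∈ Δ, s ⊆ G) {a : Mon n}
    (ha : monomial a (1 : k) ∈ M) : IsAcyclic k G (facesLE Δ G a) := by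
  obtain ⟨-, h0, h1⟩ := hres
  intro c hc hz
  have key : ∀ j : ℕ, ∃ b : Finset (Mon n) → k, (∀ s ∉ facesLE Δ G a, b s = 0) ∧
      boundary k G b = fun s => if s.card = j then c s else 0 := by
    intro j
    obtain ⟨z, hzc⟩ := exists_homogenize_eq (k := k) hG (j := j) {a}
      (fun a' t => if a' = a ∧ t.card = j then c t else 0) (by
        intro a' t h
        split_ifs with h'
        · obtain ⟨rfl, h'⟩ := h'
          refine hc t fun h2 => h ?_
          rw [mem_facesLE hG] at h2
          exact ⟨h2.1, h2.2, h'⟩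
        · rfl)
    simp only [Finset.sum_singleton, true_and] at hzc
    have hy : ∃ y, differential k Δ j y = z := by
      cases j with
      | zero =>
        -- In degree zero the chain is a scalar multiple of the monomial of `a`, which the
        -- augmentation kills because of `ha`.
        refine (h0 z).1 ?_
        rw [augmentation_eq, Ideal.Quotient.eq_zero_iff_mem, hzc]
        have := M.mul_mem_left (C (if (∅ : Finset (Mon n)).card = 0 then c ∅ else 0)) ha
        rwa [C_mul_monomial, mul_one] at this
      | succ j =>
        refine (h1 j z).1 ?_
        apply homogenize_injective
        rw [homogenize_differential hG, homogenize_zero]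
        ext t a'
        have h2 := congrFun (coeff_boundary (G := G) (homogenize z) a') t
        rw [h2]
        simp only [hzc, coeff_monomial]
        by_cases haa : a = a'
        · simp only [haa, if_true]
          rw [boundary_homogeneous, hz]
          simp
        · simp only [haa, if_false]
          rw [show (fun _ : Finset (Mon n) => (0 : k)) = 0 from rfl, map_zero]
          simp
    obtain ⟨y, hy⟩ := hy
    refine ⟨fun s => coeff a (homogenize y s), fun s hs => ?_, ?_⟩
    · refine coeff_homogenize_of_not_le y fun h => hs ?_
      rw [mem_facesLE hG]
      exact ⟨h.1, h.2.1⟩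
    · rw [← coeff_boundary, ← homogenize_differential hG, hy]
      ext s
      simp [hzc, coeff_monomial]
  choose b hb hbc using key
  -- The cardinality of a face runs from `0` to `G.card` inclusive.
  refine ⟨∑ j ∈ Finset.range (G.card + 1), b j, fun s hs => ?_, ?_⟩
  · rw [Finset.sum_apply]
    exact Finset.sum_eq_zero fun j _ => hb j s hs
  · rw [map_sum]
    ext s
    simp only [Finset.sum_apply, hbc]
    rw [Finset.sum_ite_eq]
    split_ifs with h
    · rfl
    · refine (hc s fun h' => h ?_).symm
      rw [mem_facesLE hG] at h'
      exact Finset.mem_range.2 (Nat.lt_succ_of_le (Finset.card_le_card (hG _ h'.1)))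

/-- A cycle lifts if it lives in multidegrees in which `Δ` is acyclic. -/
theorem exists_differential_eq (hG : ∀ s ∈ Δ, s ⊆ G) {j : ℕ}
    (z : Face Δ j →₀ MvPolynomial (Fin n) k)
    (hz : ∀ a, boundary k G (fun s => coeff a (homogenize z s)) = 0)
    (hac : ∀ a s, coeff a (homogenize z s) ≠ 0 → IsAcyclic k G (facesLE Δ G a)) :
    ∃ y, differential k Δ j y = z := by
  have key : ∀ a, ∃ b : Finset (Mon n) → k,
      (∀ t, ¬ (t ∈ Δ ∧ mdeg t ≤ a ∧ t.card = j + 1) → b t = 0) ∧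
      boundary k G b = fun s => coeff a (homogenize z s) := by
    intro a
    by_cases h : ∀ s, coeff a (homogenize z s) = 0
    · refine ⟨0, fun _ _ => rfl, ?_⟩
      rw [map_zero]
      ext s
      exact (h s).symm
    · push Not at h
      obtain ⟨s, hs⟩ := h
      obtain ⟨b, hb, hbc⟩ := hac a s hs _ (fun t ht => coeff_homogenize_of_not_le z
        fun h => ht ((mem_facesLE hG).2 ⟨h.1, h.2.1⟩)) (hz a)
      refine ⟨fun t => if t.card = j + 1 then b t else 0, fun t ht => ?_, ?_⟩
      · dsimp only
        split_ifs with h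
        · exact hb t fun h' => ht (by rw [mem_facesLE hG] at h'; exact ⟨h'.1, h'.2, h⟩)
        · rfl
      · rw [boundary_homogeneous, hbc]
        ext t
        dsimp only
        split_ifs with h
        · rfl
        · exact (coeff_homogenize_of_not_le z fun h' => h h'.2.2).symm
  choose y hy hyz using key
  -- Only these finitely many multidegrees occur in `z`, so finitely many lifts have to be added.
  let A := G.powerset.biUnion fun s => (homogenize z s).support
  obtain ⟨w, hw⟩ := exists_homogenize_eq hG A y hy
  refine ⟨w, homogenize_injective ?_⟩
  rw [homogenize_differential hG]
  ext t a
  have h2 := congrFun (coeff_boundary (G := G) (homogenize w) a) t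
  rw [h2]
  simp only [hw, coeff_sum, coeff_monomial, Finset.sum_ite_eq']
  by_cases haA : a ∈ A
  · simp only [haA, if_true]
    exact congrFun (hyz a) t
  · simp only [haA, if_false]
    rw [show (fun _ : Finset (Mon n) => (0 : k)) = 0 from rfl, map_zero, Pi.zero_apply]
    symm
    by_contra h
    by_cases ht : t ∈ Δ
    · exact haA (Finset.mem_biUnion.2 ⟨t, Finset.mem_powerset.2 (hG t ht), mem_support_iff.2 h⟩)
    · exact h (coeff_homogenize_of_not_le z fun h' => ht h'.1)

/-- If `Δ` is acyclic in each multidegree that belongs to `M`, then it carries a resolution. -/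
theorem isResolution_of_isAcyclic (hG : ∀ s ∈ Δ, s ⊆ G) (hempty : ∅ ∈ Δ)
    (hM : M = Ideal.span ((fun a => monomial a (1 : k)) '' (G : Set (Mon n))))
    (hac : ∀ a, (∃ g ∈ G, g ≤ a) → IsAcyclic k G (facesLE Δ G a)) : IsResolution Δ M := by
  refine ⟨fun q => ?_, fun z => ⟨fun hz => ?_, ?_⟩, fun j z => ⟨fun hz => ?_, ?_⟩⟩
  · obtain ⟨r, rfl⟩ := Ideal.Quotient.mk_surjective q
    refine ⟨Finsupp.single ⟨∅, hempty, rfl⟩ r, ?_⟩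
    rw [augmentation_eq, homogenize_single, Pi.single_eq_same]
    have : mdeg (∅ : Finset (Mon n)) = 0 := rfl
    simp [this]
  · rw [augmentation_eq, Ideal.Quotient.eq_zero_iff_mem] at hz
    refine exists_differential_eq hG z (fun a => ?_) fun a s hs => hac a ?_
    · rw [← boundary_homogeneous_zero (fun s => coeff a (homogenize z s))]
      congr 1
      ext s
      split_ifs with h
      · rfl
      · exact coeff_homogenize_of_not_le z fun h' => h h'.2.2
    · by_cases h : s.card = 0
      · rw [Finset.card_eq_zero] at h
        subst h
        rw [hM, mem_ideal_span_monomial_image] at hz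
        exact hz a (mem_support_iff.2 hs)
      · exact absurd (coeff_homogenize_of_not_le z fun h' => h h'.2.2) hs
  · rintro ⟨y, rfl⟩
    rw [augmentation_eq, Ideal.Quotient.eq_zero_iff_mem, homogenize_differential hG,
      boundary_apply]
    refine M.sum_mem fun g hg => M.mul_mem_left _ ?_
    by_cases h : insert g ∅ ∈ Δ ∧ (insert g ∅ : Finset (Mon n)).card = 0 + 1
    · rw [homogenize_face y ⟨_, h⟩]
      refine M.mul_mem_right _ ?_
      rw [hM]
      refine Ideal.subset_span ⟨g, (Finset.mem_sdiff.1 hg).1, ?_⟩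
      simp [mdeg]
    · rw [homogenize_of_not y h]
      exact M.zero_mem
  · refine exists_differential_eq hG z (fun a => ?_) fun a s hs => hac a ?_
    · rw [← coeff_boundary, ← homogenize_differential hG, hz, homogenize_zero]
      ext s
      simp
    -- In positive degree a face has a vertex, which is a generator dividing `a`.
    · by_contra hno
      refine hs (coeff_homogenize_of_not_le z ?_)
      rintro ⟨h1, h2, h3⟩
      obtain ⟨g, hg⟩ := Finset.card_pos.1 (h3 ▸ Nat.succ_pos j : 0 < s.card)
      exact hno ⟨g, hG s h1 hg, (Finset.le_sup (f := id) hg).trans h2⟩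
  · rintro ⟨y, rfl⟩
    exact differential_differential hG y

end Resolution

/-! ### Matching and collapsing the shared faces -/

section Matching

variable {n : ℕ} {G : Finset (Mon n)} {p q : Mon n}

theorem mdeg_insert (s : Finset (Mon n)) (g : Mon n) : mdeg (insert g s) = g ⊔ mdeg s :=
  Finset.sup_insert

theorem le_mdeg {s : Finset (Mon n)} {g : Mon n} (h : g ∈ s) : g ≤ mdeg s :=
  Finset.le_sup (f := id) h

theorem mdeg_insert_of_le {s : Finset (Mon n)} {g : Mon n} (h : g ≤ mdeg s) :
    mdeg (insert g s) = mdeg s := by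
  rw [mdeg_insert, sup_eq_right.2 h]

theorem mdeg_erase_of_le {s : Finset (Mon n)} {g : Mon n} (h : g ≤ mdeg (s.erase g)) :
    mdeg (s.erase g) = mdeg s := by
  by_cases hg : g ∈ s
  · rw [← mdeg_insert_of_le h, Finset.insert_erase hg]
  · rw [Finset.erase_eq_of_notMem hg]

/-- Sets of monomials with the same multidegree have the same dominant elements. -/
theorem IsDominant.mem_of_mdeg_eq {g : Mon n} (hg : IsDominant (G : Set (Mon n)) g)
    {s t : Finset (Mon n)} (ht : t ⊆ G) (hst : mdeg s = mdeg t) (hgs : g ∈ s) : g ∈ t := by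
  obtain ⟨x, e, he, hex, hdom⟩ := hg
  by_contra hgt
  -- Positivity of `e` covers the case where `t` is empty.
  have h1 : mdeg t x < e := by
    refine Finset.sup_induction (p := fun m : Mon n => m x < e) he (fun a ha b hb => ?_)
      fun b hb => ?_
    · rw [Finsupp.sup_apply]
      exact sup_lt_iff.2 ⟨ha, hb⟩
    · exact not_le.1 (hdom b (ht hb) (by rintro rfl; exact hgt hb))
  have h2 : g x ≤ mdeg t x := hst ▸ le_mdeg hgs x
  omega

variable (G) in
/-- The multidegree of `s` is shared by another set of elements of `G`. -/
def IsShared (s : Finset (Mon n)) : Prop := ∃ t ⊆ G, mdeg t = mdeg s ∧ t ≠ s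

variable (G p q) in
/-- Sets of elements of `G` with the same multidegree differ only in `p` and `q`, and no
multidegree class consists of three sets. -/
structure IsExceptionalPair : Prop where
  left_mem : p ∈ G
  right_mem : q ∈ G
  ne : p ≠ q
  mem_of_mdeg_eq : ∀ s t, s ⊆ G → t ⊆ G → mdeg s = mdeg t → ∀ g ∈ s, g ≠ p → g ≠ q → g ∈ t
  not_three : ∀ s ⊆ G, p ∉ s → q ∉ s → q ≤ mdeg (insert p s) → p ≤ mdeg (insert q s) →
    p ≤ mdeg s

open Classical in
variable (p q) in
/-- The vertex to be added to or deleted from `s` by the matching on the shared faces. -/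
noncomputable def pivot (s : Finset (Mon n)) : Mon n := if p ≤ mdeg (s.erase p) then p else q

theorem pivot_eq_or (s : Finset (Mon n)) : pivot p q s = p ∨ pivot p q s = q := by
  unfold pivot; split_ifs <;> simp

theorem pivot_eq_left_iff (hpq : p ≠ q) {s : Finset (Mon n)} :
    pivot p q s = p ↔ p ≤ mdeg (s.erase p) := by
  unfold pivot; split_ifs with h <;> simp [h, hpq.symm]

theorem pivot_congr {s t : Finset (Mon n)}
    (h : p ≤ mdeg (s.erase p) ↔ p ≤ mdeg (t.erase p)) : pivot p q s = pivot p q t := by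
  unfold pivot; simp only [h]

namespace IsExceptionalPair

theorem pivot_mem (h : IsExceptionalPair G p q) (s : Finset (Mon n)) : pivot p q s ∈ G := by
  rcases pivot_eq_or (p := p) (q := q) s with h1 | h1 <;> rw [h1]
  exacts [h.left_mem, h.right_mem]

/-- If toggling `p` and toggling `q` both changed the multidegree, a set `t` of the same multidegree
could neither contain an element outside `s` nor omit one of `s`: outside `p`, `q` the two sets
agree. So `s` would not be shared. -/
theorem pivot_le (h : IsExceptionalPair G p q) {s : Finset (Mon n)} (hs : s ⊆ G)
    (hsh : IsShared G s) : pivot p q s ≤ mdeg (s.erase (pivot p q s)) := by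
  by_cases hp : p ≤ mdeg (s.erase p)
  · rwa [(pivot_eq_left_iff h.ne).2 hp]
  have hq : pivot p q s = q := (pivot_eq_or s).resolve_left fun h1 =>
    hp ((pivot_eq_left_iff h.ne).1 h1)
  rw [hq]
  by_contra hq'
  obtain ⟨t, ht, hts, hne⟩ := hsh
  have hout : ∀ g ∈ t, g ∈ s := by
    intro g hg
    by_contra hgs
    have h1 : g ≤ mdeg (s.erase g) := by
      rw [Finset.erase_eq_of_notMem hgs, ← hts]
      exact le_mdeg hg
    by_cases hgp : g = p
    · exact hp (hgp ▸ h1)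
    by_cases hgq : g = q
    · exact hq' (hgq ▸ h1)
    exact hgs (h.mem_of_mdeg_eq t s ht hs hts g hg hgp hgq)
  apply hne
  refine Finset.Subset.antisymm hout fun g hg => ?_
  by_contra hgt
  have h1 : g ≤ mdeg (s.erase g) := by
    refine (le_mdeg hg).trans (hts ▸ mdeg_mono fun x hx => Finset.mem_erase.2 ⟨?_, hout x hx⟩)
    rintro rfl
    exact hgt hx
  by_cases hgp : g = p
  · exact hp (hgp ▸ h1)
  by_cases hgq : g = q
  · exact hq' (hgq ▸ h1)
  exact hgt (h.mem_of_mdeg_eq s t hs ht hts.symm g hg hgp hgq)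

/-- Deleting a vertex cannot make `p` divide the lcm of the others if it did not before. Together
with `pivot_insert` this makes the matching an involution on shared faces. -/
theorem pivot_erase (h : IsExceptionalPair G p q) (s : Finset (Mon n)) :
    pivot p q (s.erase (pivot p q s)) = pivot p q s := by
  by_cases hp : p ≤ mdeg (s.erase p)
  · rw [(pivot_eq_left_iff h.ne).2 hp, pivot_eq_left_iff h.ne, Finset.erase_idem]
    exact hp
  · apply pivot_congr
    refine iff_of_false (fun h1 => hp (h1.trans (mdeg_mono ?_))) hp
    exact Finset.erase_subset_erase _ (Finset.erase_subset _ _)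

/-- The danger is that adding `q` changes the pivot to `p`. If `p ∈ s`, this would create a class of
three, contrary to `not_three`; if `p ∉ s`, adding `q` leaves the relevant lcm unchanged. -/
theorem pivot_insert (h : IsExceptionalPair G p q) {s : Finset (Mon n)} (hs : s ⊆ G)
    (hsh : IsShared G s) (hps : pivot p q s ∉ s) :
    pivot p q (insert (pivot p q s) s) = pivot p q s := by
  have hle := h.pivot_le hs hsh
  rw [Finset.erase_eq_of_notMem hps] at hle
  by_cases hp : p ≤ mdeg (s.erase p)
  · have h1 := (pivot_eq_left_iff h.ne).2 hp
    rw [h1] at hps ⊢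
    rw [pivot_eq_left_iff h.ne, Finset.erase_insert hps]
    rwa [Finset.erase_eq_of_notMem hps] at hp
  have hq : pivot p q s = q := (pivot_eq_or s).resolve_left fun h1 =>
    hp ((pivot_eq_left_iff h.ne).1 h1)
  apply pivot_congr
  rw [hq] at hle hps ⊢
  refine iff_of_false (fun h1 => hp ?_) hp
  rw [Finset.erase_insert_of_ne h.ne.symm] at h1
  by_cases hps' : p ∈ s
  · refine h.not_three (s.erase p) ((Finset.erase_subset _ _).trans hs)
      (Finset.notMem_erase _ _) (fun h2 => hps (Finset.mem_of_mem_erase h2)) ?_ h1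
    rwa [Finset.insert_erase hps']
  · rw [Finset.erase_eq_of_notMem hps'] at h1 ⊢
    rwa [mdeg_insert_of_le hle] at h1

theorem mdeg_insert_pivot (h : IsExceptionalPair G p q) {s : Finset (Mon n)} (hs : s ⊆ G)
    (hsh : IsShared G s) : mdeg (insert (pivot p q s) s) = mdeg s :=
  mdeg_insert_of_le ((h.pivot_le hs hsh).trans (mdeg_mono (Finset.erase_subset _ _)))

theorem isShared_insert_pivot (h : IsExceptionalPair G p q) {s : Finset (Mon n)} (hs : s ⊆ G)
    (hsh : IsShared G s) (hps : pivot p q s ∉ s) : IsShared G (insert (pivot p q s) s) :=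
  ⟨s, hs, (h.mdeg_insert_pivot hs hsh).symm, fun h1 =>
    hps (Finset.insert_eq_self.1 h1.symm)⟩

theorem mdeg_erase_pivot (h : IsExceptionalPair G p q) {s : Finset (Mon n)} (hs : s ⊆ G)
    (hsh : IsShared G s) : mdeg (s.erase (pivot p q s)) = mdeg s :=
  mdeg_erase_of_le (h.pivot_le hs hsh)

theorem isShared_erase_pivot (h : IsExceptionalPair G p q) {s : Finset (Mon n)} (hs : s ⊆ G)
    (hsh : IsShared G s) (hps : pivot p q s ∈ s) : IsShared G (s.erase (pivot p q s)) :=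
  ⟨s, hs, (h.mdeg_erase_pivot hs hsh).symm, fun h1 =>
    Finset.erase_eq_self.1 h1.symm hps⟩

/-- Adding a vertex to a shared face without changing the multidegree adds the pivot, if the
larger face is obtained from its own matching partner by adding a vertex. -/
theorem eq_pivot_of_insert (h : IsExceptionalPair G p q) {s : Finset (Mon n)} {u : Mon n}
    (hs : s ⊆ G) (hsh : IsShared G s) (hps : pivot p q s ∉ s) (hu : u ∈ G) (hus : u ∉ s)
    (hdeg : mdeg (insert u s) = mdeg s) (hmem : pivot p q (insert u s) ∈ insert u s) :
    u = pivot p q s := by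
  by_contra hne
  have hle := (h.pivot_le hs hsh).trans (mdeg_mono (Finset.erase_subset _ _))
  have hule : u ≤ mdeg s := hdeg ▸ le_mdeg (Finset.mem_insert_self u s)
  have hupq : u = p ∨ u = q := by
    by_contra! hcon
    exact hus (h.mem_of_mdeg_eq _ _ (Finset.insert_subset hu hs) hs hdeg u
      (Finset.mem_insert_self u s) hcon.1 hcon.2)
  -- Here `u` and the pivot are `p` and `q` in some order. Then `p` is the pivot of both faces, so
  -- `u` is `q` and the larger face misses its pivot.
  have hp : p ∉ s ∧ q ∉ s ∧ p ≤ mdeg s := by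
    rcases hupq with rfl | rfl <;>
    rcases pivot_eq_or (p := _) (q := _) s with h1 | h1 <;> rw [h1] at hne hps hle
    · exact absurd rfl hne
    · exact ⟨hus, hps, hule⟩
    · exact ⟨hps, hus, hle⟩
    · exact absurd rfl hne
  obtain ⟨hp, hq, hple⟩ := hp
  have h1 : pivot p q s = p := by
    rw [pivot_eq_left_iff h.ne, Finset.erase_eq_of_notMem hp]
    exact hple
  have h2 : pivot p q (insert u s) = p := by
    rw [pivot_eq_left_iff h.ne]
    refine hple.trans (mdeg_mono fun x hx => ?_)
    exact Finset.mem_erase.2 ⟨fun h3 => hp (h3 ▸ hx), Finset.mem_insert_of_mem hx⟩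
  rw [h2] at hmem
  rcases Finset.mem_insert.1 hmem with h3 | h3
  · exact hne (h3 ▸ h1.symm)
  · exact hp h3

/-- Collapsing the matched pairs of shared faces, in an order of decreasing multidegree and
cardinality, one reaches the subcomplex of the faces that are not shared. -/
theorem isAcyclic_of_matching {R : Type*} [CommRing R] (h : IsExceptionalPair G p q)
    (hup : ∀ s t, t ⊆ G → s ⊆ t → IsShared G s → IsShared G t)
    (F : Finset (Finset (Mon n))) (hFG : ∀ s ∈ F, s ⊆ G) (hlow : ∀ s ∈ F, ∀ t ⊆ s, t ∈ F)
    (hclosed : ∀ s ∈ F, IsShared G s → pivot p q s ∉ s → insert (pivot p q s) s ∈ F)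
    (hF : IsAcyclic R G F) (E : Finset (Finset (Mon n)))
    (hE : ∀ s, s ∈ E ↔ s ∈ F ∧ ¬ IsShared G s) : IsAcyclic R G E := by
  classical
  induction F using Finset.strongInduction with
  | H F ih =>
  by_cases hall : ∀ s ∈ F, ¬ IsShared G s
  · convert hF
    ext s
    rw [hE]
    exact ⟨fun h => h.1, fun h => ⟨h, hall s h⟩⟩
  push Not at hall
  obtain ⟨t, htF, hsh⟩ := hall
  let L := F.filter fun s => IsShared G s ∧ pivot p q s ∉ s
  have hL : ∀ {s}, s ∈ L ↔ s ∈ F ∧ IsShared G s ∧ pivot p q s ∉ s := Finset.mem_filter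
  have herase : ∀ t ∈ F, IsShared G t → pivot p q t ∈ t → t.erase (pivot p q t) ∈ L := by
    intro t htF hsh hpt
    refine hL.2 ⟨hlow t htF _ (Finset.erase_subset _ _),
      h.isShared_erase_pivot (hFG t htF) hsh hpt, ?_⟩
    rw [h.pivot_erase]
    exact Finset.notMem_erase _ _
  have hLne : L.Nonempty := by
    by_cases hpt : pivot p q t ∈ t
    · exact ⟨_, herase t htF hsh hpt⟩
    · exact ⟨t, hL.2 ⟨htF, hsh, hpt⟩⟩
  obtain ⟨m, hm⟩ := (L.image mdeg).exists_maximal (hLne.image _)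
  obtain ⟨s₀, hs₀, hs₀m⟩ := Finset.mem_image.1 hm.1
  obtain ⟨s, hs, hmax⟩ := (L.filter fun s => mdeg s = m).exists_max_image Finset.card
    ⟨s₀, Finset.mem_filter.2 ⟨hs₀, hs₀m⟩⟩
  obtain ⟨hsL, hsm⟩ := Finset.mem_filter.1 hs
  obtain ⟨hsF, hssh, hps⟩ := hL.1 hsL
  have hcard : ∀ r ∈ L, mdeg s ≤ mdeg r → mdeg r = mdeg s ∧ r.card ≤ s.card := by
    intro r hr hle
    have h1 : mdeg r = mdeg s :=
      le_antisymm (hsm ▸ hm.2 (Finset.mem_image_of_mem _ hr) (hsm ▸ hle)) hle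
    exact ⟨h1, hmax r (Finset.mem_filter.2 ⟨hr, h1.trans hsm⟩)⟩
  -- A face `t` above `s` is shared. It is not the lower member of its pair, by maximality of `s`.
  -- If it is the upper one, its partner has at most as many vertices as `s`, so `t` has exactly one
  -- more than `s`.
  have hfree : ∀ t ∈ F, s ⊂ t → t = insert (pivot p q s) s := by
    intro t htF hst
    have htsh : IsShared G t := hup s t (hFG t htF) hst.1 hssh
    have hlt := Finset.card_lt_card hst
    by_cases hpt : pivot p q t ∈ t
    · have hdeg := h.mdeg_erase_pivot (hFG t htF) htsh
      obtain ⟨h1, h2⟩ := hcard _ (herase t htF htsh hpt) (hdeg ▸ mdeg_mono hst.1)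
      rw [Finset.card_erase_of_mem hpt] at h2
      obtain ⟨u, hu, rfl⟩ : ∃ u ∉ s, insert u s = t :=
        (Finset.covBy_iff_exists_insert).1 (Finset.covBy_iff_card_sdiff_eq_one.2 ⟨hst.1, by
          rw [Finset.card_sdiff_of_subset hst.1]; omega⟩)
      rw [← h.eq_pivot_of_insert (hFG s hsF) hssh hps
        (hFG _ htF (Finset.mem_insert_self u s)) hu (hdeg.symm.trans h1) hpt]
    · have := (hcard t (hL.2 ⟨htF, htsh, hpt⟩) (mdeg_mono hst.1)).2
      omega
  have heF := hclosed s hsF hssh hps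
  have hesh := h.isShared_insert_pivot (hFG s hsF) hssh hps
  have hepiv := h.pivot_insert (hFG s hsF) hssh hps
  set e := insert (pivot p q s) s with he
  have hmem : ∀ {r}, r ∈ (F.erase s).erase e ↔ r ≠ e ∧ r ≠ s ∧ r ∈ F := by
    intro r; simp only [Finset.mem_erase]
  refine ih ((F.erase s).erase e) ?_ ?_ ?_ ?_ ?_ ?_
  · refine ⟨fun r hr => (hmem.1 hr).2.2, fun hsub => ?_⟩
    exact (hmem.1 (hsub hsF)).2.1 rfl
  · exact fun r hr => hFG r (hmem.1 hr).2.2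
  · intro r hr t htr
    obtain ⟨h1, h2, h3⟩ := hmem.1 hr
    have hsr : ¬ s ⊆ r := fun h4 => h1 (hfree r h3 (h4.ssubset_of_ne (Ne.symm h2)))
    refine hmem.2 ⟨?_, ?_, hlow r h3 t htr⟩
    · rintro rfl
      exact hsr ((Finset.subset_insert _ _).trans htr)
    · rintro rfl
      exact hsr htr
  · intro r hr hrsh hpr
    obtain ⟨h1, h2, h3⟩ := hmem.1 hr
    have hpiv := h.pivot_insert (hFG r h3) hrsh hpr
    refine hmem.2 ⟨fun h4 => h2 ?_, fun h4 => hps ?_, hclosed r h3 hrsh hpr⟩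
    · rw [h4, hepiv] at hpiv
      have h5 := Finset.erase_insert hpr
      rw [h4, ← hpiv, he, Finset.erase_insert hps] at h5
      exact h5.symm
    · rw [h4] at hpiv
      rw [hpiv, ← h4]
      exact Finset.mem_insert_self _ _
  · exact hF.collapse hlow hps (h.pivot_mem s) heF hfree
  · intro r
    rw [hE, hmem]
    refine ⟨fun h1 => ⟨⟨?_, ?_, h1.1⟩, h1.2⟩, fun h1 => ⟨h1.1.2.2, h1.2⟩⟩
    · rintro rfl; exact h1.2 hesh
    · rintro rfl; exact h1.2 hssh

end IsExceptionalPair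

end Matching

/-! ### The two directions of the characterization -/

section Scarf

variable {k : Type*} [Field k] {n : ℕ} (M : Ideal (MvPolynomial (Fin n) k))

/-- The minimal generators as a finite set. -/
noncomputable def gens : Finset (Mon n) := (minGens_finite M).toFinset

variable {M}

theorem mem_gens {g : Mon n} : g ∈ gens M ↔ g ∈ minGens M := (minGens_finite M).mem_toFinset

theorem coe_gens : (gens M : Set (Mon n)) = minGens M := (minGens_finite M).coe_toFinset

theorem mem_taylorBasis {s : Finset (Mon n)} : s ∈ taylorBasis M ↔ s ⊆ gens M :=
  Finset.mem_powerset

theorem mem_taylorBasisOfMdeg {m : Mon n} {s : Finset (Mon n)} :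
    s ∈ taylorBasisOfMdeg M m ↔ s ⊆ gens M ∧ mdeg s = m := by
  rw [taylorBasisOfMdeg, Finset.mem_filter, mem_taylorBasis]

theorem subset_gens_of_mem_scarfComplex : ∀ s ∈ scarfComplex M, s ⊆ gens M :=
  fun _ hs => mem_taylorBasis.1 hs.1

theorem mem_scarfComplex {s : Finset (Mon n)} :
    s ∈ scarfComplex M ↔ s ⊆ gens M ∧ ¬ IsShared (gens M) s := by
  change (s ∈ taylorBasis M ∧ ∀ t ∈ taylorBasis M, mdeg t = mdeg s → t = s) ↔ _
  simp only [mem_taylorBasis, IsShared, not_exists, not_and, not_not]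

theorem isShared_of_subset (s t : Finset (Mon n)) (ht : t ⊆ gens M) (hst : s ⊆ t)
    (hs : IsShared (gens M) s) : IsShared (gens M) t := by
  by_contra h
  exact (mem_scarfComplex.1 ((scarfComplex M).lower hst (mem_scarfComplex.2 ⟨ht, h⟩))).2 hs

theorem monomial_mem_of_le {a g : Mon n} (hg : g ∈ gens M) (hga : g ≤ a) :
    monomial a (1 : k) ∈ M := by
  have h1 : monomial g (1 : k) ∈ M := (mem_gens.1 hg).1
  have h2 := M.mul_mem_left (monomial (a - g) 1) h1
  rwa [monomial_mul, one_mul, tsub_add_cancel_of_le hga] at h2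

open Classical in
theorem mem_powerset_filter_le_iff {s : Finset (Mon n)} {a : Mon n} :
    s ∈ ((gens M).filter (· ≤ a)).powerset ↔ s ⊆ gens M ∧ mdeg s ≤ a := by
  rw [Finset.mem_powerset, mdeg, Finset.sup_le_iff]
  simp only [Finset.subset_iff, Finset.mem_filter, id]
  exact ⟨fun h => ⟨fun x hx => (h hx).1, fun x hx => (h hx).2⟩,
    fun h x hx => ⟨h.1 hx, h.2 x hx⟩⟩

open Classical in
/-- If `M` is Scarf then in each multidegree an even number of faces is shared. -/
theorem IsScarf.even_card_shared (hM : IsScarf M) (a : Mon n) :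
    Even ((((gens M).filter (· ≤ a)).powerset).filter (IsShared (gens M))).card := by
  have hsc := Finset.card_filter_add_card_filter_not (s := ((gens M).filter (· ≤ a)).powerset)
    (IsShared (gens M))
  by_cases hne : ((gens M).filter (· ≤ a)).Nonempty
  · obtain ⟨g, hg⟩ := hne
    have hg' := Finset.mem_filter.1 hg
    have h1 := (IsResolution.isAcyclic hM subset_gens_of_mem_scarfComplex
      (monomial_mem_of_le hg'.1 hg'.2)).even_card
      (facesLE_lower subset_gens_of_mem_scarfComplex)
    have h2 : facesLE (scarfComplex M) (gens M) a =
        (((gens M).filter (· ≤ a)).powerset).filter fun s => ¬ IsShared (gens M) s := by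
      ext s
      rw [mem_facesLE subset_gens_of_mem_scarfComplex, mem_scarfComplex, Finset.mem_filter,
        mem_powerset_filter_le_iff]
      tauto
    have h3 : Even (((gens M).filter (· ≤ a)).powerset).card := by
      rw [Finset.card_powerset]
      exact Nat.even_pow.2 ⟨even_two, (Finset.card_pos.2 ⟨g, hg⟩).ne'⟩
    rw [← h2] at hsc
    rw [← hsc] at h3
    exact (Nat.even_add.1 h3).2 h1
  -- Here the simplex has a single face, an odd number, but that face shares its multidegree with no
  -- other.
  · rw [Finset.not_nonempty_iff_eq_empty] at hne
    rw [Finset.filter_false_of_mem, Finset.card_empty]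
    · exact Even.zero
    · intro s hs
      rintro ⟨t, ht, hts, hne'⟩
      have ht' : t ∈ ((gens M).filter (· ≤ a)).powerset :=
        mem_powerset_filter_le_iff.2 ⟨ht, hts ▸ (mem_powerset_filter_le_iff.1 hs).2⟩
      rw [hne, Finset.powerset_empty, Finset.mem_singleton] at hs ht'
      exact hne' (ht'.trans hs.symm)

/-- In a Scarf ideal every multidegree that is shared is shared by an even number of basis
elements of the Taylor resolution. -/
theorem IsScarf.even_card_taylorBasisOfMdeg (hM : IsScarf M) {m : Mon n}
    (hm : 1 < (taylorBasisOfMdeg M m).card) : Even (taylorBasisOfMdeg M m).card := by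
  classical
  -- Keeping only shared faces empties the singleton classes, so evenness holds in every multidegree
  -- and the induction can run.
  let B : Mon n → Finset (Finset (Mon n)) :=
    fun m => (taylorBasisOfMdeg M m).filter (IsShared (gens M))
  have hB : ∀ m, Even (B m).card := by
    intro m
    induction m using WellFoundedLT.induction with
    | ind m ih =>
    have h1 := hM.even_card_shared m
    rw [Finset.card_eq_sum_card_fiberwise (f := mdeg) (t := Finset.Iic m)] at h1
    · rw [← Finset.add_sum_erase _ _ (Finset.mem_Iic.2 (le_refl m))] at h1
      have h2 : ∀ a ∈ Finset.Iic m, ((((gens M).filter (· ≤ m)).powerset).filter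
          (IsShared (gens M))).filter (fun s => mdeg s = a) = B a := by
        intro a ha
        ext s
        simp only [B, Finset.mem_filter, mem_powerset_filter_le_iff, mem_taylorBasisOfMdeg]
        constructor
        · rintro ⟨⟨⟨h3, -⟩, h4⟩, h5⟩
          exact ⟨⟨h3, h5⟩, h4⟩
        · rintro ⟨⟨h3, h5⟩, h4⟩
          exact ⟨⟨⟨h3, h5.trans_le (Finset.mem_Iic.1 ha)⟩, h4⟩, h5⟩
      rw [h2 m (Finset.mem_Iic.2 le_rfl)] at h1
      refine (Nat.even_add.1 h1).2 (Finset.even_sum _ fun a ha => ?_)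
      rw [Finset.mem_erase] at ha
      rw [h2 a ha.2]
      exact ih a (lt_of_le_of_ne (Finset.mem_Iic.1 ha.2) ha.1)
    · intro s hs
      have := (Finset.mem_filter.1 (Finset.mem_coe.1 hs)).1
      exact Finset.mem_coe.2 (Finset.mem_Iic.2 (mem_powerset_filter_le_iff.1 this).2)
  have h1 : B m = taylorBasisOfMdeg M m := by
    refine Finset.filter_true_of_mem fun s hs => ?_
    obtain ⟨t, ht, hts⟩ := Finset.exists_mem_ne hm s
    rw [mem_taylorBasisOfMdeg] at hs ht
    exact ⟨t, ht.1, ht.2.trans hs.2.symm, hts⟩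
  rw [← h1]
  exact hB m

/-- If the ideal is 2-semidominant and no multidegree is shared by an odd number of basis
elements, the nondominant generators form an exceptional pair. -/
theorem exists_isExceptionalPair (hM : IsSemidominantSet 2 (minGens M))
    (heven : ∀ m : Mon n, 1 < (taylorBasisOfMdeg M m).card → Even (taylorBasisOfMdeg M m).card) :
    ∃ p q, IsExceptionalPair (gens M) p q := by
  obtain ⟨p, q, hpq, hset⟩ := Set.encard_eq_two.1 hM
  have hp : p ∈ minGens M := (hset.symm ▸ Set.mem_insert p {q} :
    p ∈ {m ∈ minGens M | ¬ IsDominant (minGens M) m}).1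
  have hq : q ∈ minGens M := (hset.symm ▸ Set.mem_insert_of_mem p rfl :
    q ∈ {m ∈ minGens M | ¬ IsDominant (minGens M) m}).1
  have hdom : ∀ s t, s ⊆ gens M → t ⊆ gens M → mdeg s = mdeg t → ∀ g ∈ s, g ≠ p → g ≠ q →
      g ∈ t := by
    intro s t hs ht hst g hg hgp hgq
    refine IsDominant.mem_of_mdeg_eq (G := gens M) ?_ ht hst hg
    rw [coe_gens]
    by_contra h
    have : g ∈ ({p, q} : Set (Mon n)) := hset ▸ ⟨mem_gens.1 (hs hg), h⟩
    rcases this with h1 | h1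
    exacts [hgp h1, hgq h1]
  refine ⟨p, q, mem_gens.2 hp, mem_gens.2 hq, hpq, hdom, ?_⟩
  intro s hs hps hqs h1 h2
  -- A failure makes `insert p s`, `insert q s` and their union a full class of three, which `s`
  -- itself misses.
  by_contra hnot
  have hqn : ¬ q ≤ mdeg s := fun h3 => hnot (by rwa [mdeg_insert_of_le h3] at h2)
  have h12 : mdeg (insert q (insert p s)) = mdeg (insert p s) := mdeg_insert_of_le h1
  have h12' : mdeg (insert p (insert q s)) = mdeg (insert q s) := mdeg_insert_of_le h2
  rw [Finset.insert_comm] at h12'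
  have hsp : insert p s ⊆ gens M := Finset.insert_subset (mem_gens.2 hp) hs
  have hsq : insert q s ⊆ gens M := Finset.insert_subset (mem_gens.2 hq) hs
  have hspq : insert q (insert p s) ⊆ gens M := Finset.insert_subset (mem_gens.2 hq) hsp
  have hB : taylorBasisOfMdeg M (mdeg (insert p s)) =
      {insert p s, insert q s, insert q (insert p s)} := by
    ext t
    rw [mem_taylorBasisOfMdeg]
    simp only [Finset.mem_insert, Finset.mem_singleton]
    constructor
    · rintro ⟨ht, htm⟩
      have hsub : ∀ x ∈ s, x ∈ t := fun x hx => hdom _ t hsp ht htm.symm x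
        (Finset.mem_insert_of_mem hx) (by rintro rfl; exact hps hx) (by rintro rfl; exact hqs hx)
      have hsup : ∀ x ∈ t, x ≠ p → x ≠ q → x ∈ s := fun x hx hxp hxq =>
        Finset.mem_of_mem_insert_of_ne (hdom t _ ht hsp htm x hx hxp hxq) hxp
      by_cases hpt : p ∈ t <;> by_cases hqt : q ∈ t
      · right; right
        ext x; simp only [Finset.mem_insert]; grind
      · left
        ext x; simp only [Finset.mem_insert]; grind
      · right; left
        ext x; simp only [Finset.mem_insert]; grind
      · exfalso
        apply hnot
        have hts : t = s := by ext x; grind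
        rw [← hts, htm]
        exact le_mdeg (Finset.mem_insert_self _ _)
    · rintro (rfl | rfl | rfl)
      exacts [⟨hsp, rfl⟩, ⟨hsq, h12'.symm.trans h12⟩, ⟨hspq, h12⟩]
  have hcard : (taylorBasisOfMdeg M (mdeg (insert p s))).card = 3 := by
    rw [hB, Finset.card_eq_three]
    refine ⟨_, _, _, ?_, ?_, ?_, rfl⟩
    · intro h
      have : p ∈ insert q s := h ▸ Finset.mem_insert_self p s
      grind
    · intro h
      have : q ∈ insert p s := h.symm ▸ Finset.mem_insert_self q _
      grind
    · intro h
      have : p ∈ insert q s := h.symm ▸ Finset.mem_insert_of_mem (Finset.mem_insert_self p s)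
      grind
  have := heven _ (by rw [hcard]; norm_num)
  rw [hcard] at this
  exact absurd this (by decide)

theorem IsExceptionalPair.isScarf {p q : Mon n} (h : IsExceptionalPair (gens M) p q)
    (hM : IsMonomialIdeal M) : IsScarf M := by
  classical
  refine isResolution_of_isAcyclic subset_gens_of_mem_scarfComplex ?_
    (coe_gens (M := M) ▸ (span_minGens hM).symm) fun a ha => ?_
  · rw [mem_scarfComplex]
    refine ⟨Finset.empty_subset _, ?_⟩
    -- If the empty face were shared, `1` would be a minimal generator, hence the only one, against
    -- `p ≠ q`.
    rintro ⟨t, ht, ht0, hne⟩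
    obtain ⟨g, hg⟩ := Finset.nonempty_iff_ne_empty.2 hne
    have hg0 : g ≤ 0 := (le_mdeg hg).trans_eq ht0
    have hmin : ∀ r ∈ gens M, r = g := fun r hr =>
      have hr' : Minimal (fun b => monomial b (1 : k) ∈ M) r := mem_gens.1 hr
      (hr'.eq_of_le (mem_gens.1 (ht hg)).1 (hg0.trans zero_le)).symm
    exact h.ne ((hmin p h.left_mem).trans (hmin q h.right_mem).symm)
  · obtain ⟨g, hg, hga⟩ := ha
    -- The collapse starts from the full simplex on the generators dividing `a`; adding a pivot
    -- stays inside, as it keeps the multidegree.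
    refine h.isAcyclic_of_matching isShared_of_subset ((gens M).filter (· ≤ a)).powerset
      (fun s hs => (mem_powerset_filter_le_iff.1 hs).1) (fun s hs t hts => ?_)
      (fun s hs hsh _ => ?_) ?_ _ fun s => ?_
    · exact Finset.mem_powerset.2 (hts.trans (Finset.mem_powerset.1 hs))
    · rw [mem_powerset_filter_le_iff] at hs ⊢
      exact ⟨Finset.insert_subset (h.pivot_mem s) hs.1,
        (h.mdeg_insert_pivot hs.1 hsh).trans_le hs.2⟩
    · exact isAcyclic_powerset (Finset.filter_subset _ _) ⟨g, Finset.mem_filter.2 ⟨hg, hga⟩⟩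
    · rw [mem_facesLE subset_gens_of_mem_scarfComplex, mem_scarfComplex,
        mem_powerset_filter_le_iff]
      tauto

end Scarf

end MonomialResolution

theorem theorem6p7 {k : Type*} [Field k] {n : ℕ} (M : Ideal (MvPolynomial (Fin n) k))
    (hM : MonomialResolution.IsSemidominantIdeal 2 M) :
    MonomialResolution.IsScarf M ↔
      ∀ m : MonomialResolution.Mon n,
        1 < (MonomialResolution.taylorBasisOfMdeg M m).card →
          Even (MonomialResolution.taylorBasisOfMdeg M m).card := by
  refine ⟨fun h m hm => h.even_card_taylorBasisOfMdeg hm, fun h => ?_⟩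
  obtain ⟨p, q, hpq⟩ := MonomialResolution.exists_isExceptionalPair hM.2 h
  exact hpq.isScarf hM.1
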